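/- For $f\colon\mathbb R\to\mathbb C$ let $$Bf(z)=\left(\frac2\pi\right)^{1/4}\int_{\mathbb R} f(x)\,e^{2xz-x^2-z^2/2}\,dx,\qquad z\in\mathbb C,$$ denote its Bargmann transform. For $0<p\le\infty$ let $F^p$ be the space of entire functions $g$ on $\mathbb C$ such that $g(z)e^{-|z|^2/2}$ belongs to $L^p(\mathbb C,dA)$, where $dA$ is area measure, with $$\|g\|_{F^p}^p=\frac{p}{2\pi}\int_{\mathbb C}\left|g(z)e^{-\frac12|z|^2}\right|^p dA(z)\quad(p<\infty),\qquad \|g\|_{F^\infty}=\sup_{z\in\mathbb C}|g(z)|e^{-\frac12|z|^2}.$$ Then for every $2\le p\le\infty$ the Bargmann transform is a bounded linear operator from $L^p(\mathbb R)$ into $F^p$: for every $f\in L^p(\mathbb R)$ the integral defining $Bf(z)$ converges absolutely for every $z\in\mathbb C$, $Bf\in F^p$, $Bf$ depends linearly on $f$, and there is a constant $C$ depending only on $p$ such that $\|Bf\|_{F^p}\le C\|f\|_{L^p(\mathbb R)}$ for all $f\in L^p(\mathbb R)$. -/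

import Mathlib

open MeasureTheory
open scoped ENNReal NNReal

noncomputable section

/-- The integrand `f(x) e^{2xz - x² - z²/2}` of the Bargmann transform. -/
def bargmannIntegrand (f : ℝ → ℂ) (z : ℂ) (x : ℝ) : ℂ :=
  f x * Complex.exp (2 * (x : ℂ) * z - (x : ℂ) ^ 2 - z ^ 2 / 2)

/-- The Bargmann transform `Bf(z) = (2/π)^{1/4} ∫ f(x) e^{2xz - x² - z²/2} dx`. -/
def bargmann (f : ℝ → ℂ) (z : ℂ) : ℂ :=
  (((2 / Real.pi) ^ (1 / 4 : ℝ) : ℝ) : ℂ) * ∫ x : ℝ, bargmannIntegrand f z x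

/-- The Gaussian-weighted function `f(z) e^{-|z|²/2}`. -/
def fockWeighted (f : ℂ → ℂ) (z : ℂ) : ℂ :=
  f z * ((Real.exp (-(1 / 2) * ‖z‖ ^ 2) : ℝ) : ℂ)

/-- The Fock space `F^p`: entire functions `f` such that `f(z) e^{-|z|²/2}` belongs to
`L^p(ℂ, dA)`, where `dA` is area measure. -/
def fockSpace (p : ℝ≥0∞) : Submodule ℂ (ℂ → ℂ) where
  carrier := {f | Differentiable ℂ f ∧ MemLp (fockWeighted f) p volume}
  zero_mem' := by
    refine ⟨differentiable_const 0, ?_⟩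
    have h : fockWeighted (0 : ℂ → ℂ) = 0 := by
      funext z
      simp [fockWeighted]
    rw [h]
    exact MemLp.zero
  add_mem' := by
    rintro f g ⟨hf, hf'⟩ ⟨hg, hg'⟩
    refine ⟨hf.add hg, ?_⟩
    have h : fockWeighted (f + g) = fockWeighted f + fockWeighted g := by
      funext z
      simp [fockWeighted, add_mul]
    rw [h]
    exact hf'.add hg'
  smul_mem' := by
    rintro a f ⟨hf, hf'⟩
    refine ⟨hf.const_smul a, ?_⟩
    have h : fockWeighted (a • f) = a • fockWeighted f := by
      funext z
      simp [fockWeighted, mul_assoc]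
    rw [h]
    exact hf'.const_smul a

/-- The norm of `F^p`, with values in `[0, ∞]`:
`‖f‖^p = (p / 2π) ∫ |f(z) e^{-|z|²/2}|^p dA(z)` for `p < ∞`, and the supremum of
`|f(z)| e^{-|z|²/2}` over all `z` for `p = ∞`. -/
def fockENorm (p : ℝ≥0∞) (f : ℂ → ℂ) : ℝ≥0∞ :=
  if p = ∞ then ⨆ z : ℂ, ‖fockWeighted f z‖ₑ
  else (ENNReal.ofReal (p.toReal / (2 * Real.pi)) *
    ∫⁻ z : ℂ, ‖fockWeighted f z‖ₑ ^ p.toReal) ^ (1 / p.toReal)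

end

/-! Write `z = u + iv`. Completing the square shows that `Bf(z) e^{-|z|²/2}` is, up to a constant
and a unimodular factor, the Fourier transform of `f(x) e^{-(x-u)²}` at `-v/π`
(`fockWeighted_bargmann`). Two endpoints follow. For `p = ∞`, the modulus is at most a constant
times `‖f‖_∞` times the integral of the Gaussian. For `p = 2`, Plancherel in `v` and Tonelli in `u`
reduce the double integral to `‖f‖₂²` times a Gaussian integral. For `2 < p < ∞`, Marcinkiewicz's
argument applies: cut `f` at height `t`. The low part contributes at most `A t` pointwise, so
wherever the transform exceeds `2 A t` the high part exceeds `A t`; Chebyshev and the `L²` bound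
control that set, and `lintegral_rpow_le_of_meas_lt_le` integrates over `t`. -/

/-! ### Plancherel and real interpolation -/

open scoped FourierTransform ContDiff in
/-- Plancherel's theorem for functions in `L¹ ∩ L²`. -/
theorem eLpNorm_two_fourier_eq {f : ℝ → ℂ} (hf : Integrable f) (hf2 : MemLp f 2) :
    eLpNorm (𝓕 f) 2 = eLpNorm f 2 := by
  have hcont : Continuous (𝓕 f) :=
    VectorFourier.fourierIntegral_continuous Real.continuous_fourierChar
      (by fun_prop) hf
  -- The `L²` and the integral Fourier transforms agree as distributions, by the multiplication
  -- formula; hence they agree a.e.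
  have hpair : ∀ φ : SchwartzMap ℝ ℂ, ∫ x, φ x • (𝓕 (hf2.toLp f) : Lp ℂ 2 (volume : Measure ℝ)) x
      = ∫ x, φ x • 𝓕 f x := by
    intro φ
    rw [← Lp.toTemperedDistribution_apply, ← Lp.fourier_toTemperedDistribution_eq,
      TemperedDistribution.fourier_apply, Lp.toTemperedDistribution_apply]
    calc ∫ x, (𝓕 φ) x • hf2.toLp f x = ∫ x, (𝓕 (φ : ℝ → ℂ)) x • f x := by
          apply integral_congr_ae
          filter_upwards [hf2.coeFn_toLp] with x hx
          rw [hx, SchwartzMap.fourier_coe]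
      _ = ∫ x, φ x • 𝓕 f x := by
          have := VectorFourier.integral_fourierIntegral_smul_eq_flip (L := innerₗ ℝ)
            (μ := volume) (ν := volume) Real.continuous_fourierChar (by fun_prop) φ.integrable hf
          rwa [flip_innerₗ] at this
  have hae : (𝓕 (hf2.toLp f) : Lp ℂ 2 (volume : Measure ℝ)) =ᵐ[volume] 𝓕 f := by
    apply ae_eq_of_integral_contDiff_smul_eq
    · exact (Lp.memLp _).locallyIntegrable (by norm_num)
    · exact hcont.locallyIntegrable
    · intro g hg hgc
      have hgc' : HasCompactSupport (fun x => (g x : ℂ)) := hgc.comp_left Complex.ofReal_zero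
      exact hpair (hgc'.toSchwartzMap (Complex.ofRealCLM.contDiff.comp hg))
  have hnorm := Lp.norm_fourier_eq (hf2.toLp f)
  rw [← eLpNorm_congr_ae hae, ← eLpNorm_congr_ae hf2.coeFn_toLp, ← Lp.enorm_def, ← Lp.enorm_def]
  rw [← ofReal_norm, ← ofReal_norm, hnorm]

/-- A Marcinkiewicz-type estimate between `L²` and `L^∞`: a restricted `L²` bound on every
superlevel set of `f` controls the `L^p` norm of `h` for `2 < p < ∞`. -/
theorem lintegral_rpow_le_of_meas_lt_le {α β : Type*} [MeasurableSpace α] [MeasurableSpace β]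
    {μ : Measure α} {ν : Measure β} {f : α → ℝ} (hf : Measurable f) (hf0 : 0 ≤ f)
    {h : β → ℝ} (hh : AEMeasurable h ν) (hh0 : 0 ≤ h) {p : ℝ} (hp : 2 < p) {D : ℝ≥0∞} (hD : D ≠ ∞)
    (hlt : ∀ t : ℝ, 0 < t → ν {y | t < h y} ≤
      D * ENNReal.ofReal (t ^ (-2 : ℝ)) * ∫⁻ x in {x | t < f x}, ENNReal.ofReal (f x ^ (2 : ℝ)) ∂μ) :
    ∫⁻ y, ENNReal.ofReal (h y ^ p) ∂ν ≤
      ENNReal.ofReal (p / (p - 2)) * D * ∫⁻ x, ENNReal.ofReal (f x ^ p) ∂μ := by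
  have hp2 : 0 < p - 2 := by linarith
  have hp0 : 0 < p := by linarith
  -- With density `f²`, the layer-cake formula for exponent `p - 2` computes `∫ f^p`, and its
  -- level-set measures are exactly those in `hlt`.
  set w : α → ℝ≥0∞ := fun x => ENNReal.ofReal (f x ^ (2 : ℝ)) with hw
  have hwm : Measurable w := (hf.pow_const 2).ennreal_ofReal
  have hcake := lintegral_rpow_eq_lintegral_meas_lt_mul (μ.withDensity w)
    (Filter.Eventually.of_forall hf0) hf.aemeasurable hp2
  rw [lintegral_withDensity_eq_lintegral_mul _ hwm (hf.pow_const _).ennreal_ofReal] at hcake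
  have hpow : ∀ x, (w * fun ω => ENNReal.ofReal (f ω ^ (p - 2))) x = ENNReal.ofReal (f x ^ p) := by
    intro x
    simp only [hw, Pi.mul_apply]
    rw [← ENNReal.ofReal_mul (Real.rpow_nonneg (hf0 x) _),
      ← Real.rpow_add_of_nonneg (hf0 x) (by norm_num) hp2.le]
    ring_nf
  simp_rw [hpow] at hcake
  rw [lintegral_rpow_eq_lintegral_meas_lt_mul ν (Filter.Eventually.of_forall hh0) hh hp0, hcake]
  calc ENNReal.ofReal p * ∫⁻ t in Set.Ioi 0, ν {y | t < h y} * ENNReal.ofReal (t ^ (p - 1))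
      ≤ ENNReal.ofReal p * ∫⁻ t in Set.Ioi 0, D * ((μ.withDensity w) {x | t < f x} *
          ENNReal.ofReal (t ^ (p - 2 - 1))) := by
        gcongr ENNReal.ofReal p * ?_
        refine setLIntegral_mono' measurableSet_Ioi fun t ht => ?_
        rw [withDensity_apply _ (measurableSet_lt measurable_const hf)]
        refine (mul_le_mul_left (hlt t ht) _).trans_eq ?_
        have : t ^ (p - 2 - 1) = t ^ (-2 : ℝ) * t ^ (p - 1) := by
          rw [← Real.rpow_add ht]; ring_nf
        rw [this, ENNReal.ofReal_mul (Real.rpow_nonneg (le_of_lt ht) _)]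
        ring
    _ = ENNReal.ofReal (p / (p - 2)) * D * (ENNReal.ofReal (p - 2) *
          ∫⁻ t in Set.Ioi 0, (μ.withDensity w) {x | t < f x} *
            ENNReal.ofReal (t ^ (p - 2 - 1))) := by
        rw [lintegral_const_mul' _ _ hD]
        have : p = p / (p - 2) * (p - 2) := by field_simp
        conv_lhs => rw [this, ENNReal.ofReal_mul (by positivity)]
        rw [← this]
        ring

/-! ### Gaussian integrability and holomorphy -/

/-- The Gaussians `x ↦ e^{-x² + ax + b}` lie in every `L^q` with `1 ≤ q`. -/
theorem memLp_cexp_quadratic (a b : ℂ) {q : ℝ≥0∞} (hq : 1 ≤ q) :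
    MemLp (fun x : ℝ => Complex.exp (-(x : ℂ) ^ 2 + a * x + b)) q := by
  have hcont : Continuous fun x : ℝ => Complex.exp (-(x : ℂ) ^ 2 + a * x + b) := by fun_prop
  rcases eq_or_ne q ∞ with rfl | hq'
  · refine memLp_top_of_bound hcont.aestronglyMeasurable (Real.exp (a.re ^ 2 / 4 + b.re))
      (Filter.Eventually.of_forall fun x => ?_)
    rw [Complex.norm_exp, Real.exp_le_exp]
    simp only [Complex.add_re, Complex.neg_re, Complex.mul_re, Complex.ofReal_re, Complex.ofReal_im,
      mul_zero, sub_zero, pow_two]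
    nlinarith [sq_nonneg (x - a.re / 2)]
  · rw [← integrable_norm_rpow_iff hcont.aestronglyMeasurable (by positivity) hq']
    have hq0 : 0 < q.toReal := ENNReal.toReal_pos (by positivity) hq'
    have := (integrable_cexp_quadratic (b := (q.toReal : ℂ)) (by simpa using hq0)
      (q.toReal * a) (q.toReal * b)).norm
    refine this.congr (Filter.Eventually.of_forall fun x => ?_)
    simp only [Complex.norm_exp]
    rw [← Real.exp_mul]
    congr 1
    simp [pow_two]
    ring

theorem integrable_mul_cexp_quadratic {f : ℝ → ℂ} {p : ℝ≥0∞} (hp : 1 ≤ p) (hf : MemLp f p)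
    (a b : ℂ) : Integrable fun x : ℝ => f x * Complex.exp (-(x : ℂ) ^ 2 + a * x + b) := by
  have := ENNReal.HolderConjugate.inv_one_sub_inv' hp
  exact hf.integrable_mul (memLp_cexp_quadratic a b (q := (1 - p⁻¹)⁻¹) (by simp))

/-- A bilateral Laplace transform that converges absolutely on the whole plane is entire. -/
theorem differentiable_integral_mul_cexp {F : ℝ → ℂ}
    (hF : ∀ z : ℂ, Integrable fun x : ℝ => F x * Complex.exp (2 * x * z)) :
    Differentiable ℂ fun z : ℂ => ∫ x : ℝ, F x * Complex.exp (2 * x * z) := by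
  intro z₀
  -- One unit covers the ball of radius 1; the other absorbs the factor `2x` of the derivative
  -- through `|2x| ≤ e^{|2x|}`.
  set R : ℝ := |z₀.re| + 2
  have hFm : AEStronglyMeasurable F := by simpa using (hF 0).aestronglyMeasurable
  refine (hasDerivAt_integral_of_dominated_loc_of_deriv_le (Metric.ball_mem_nhds z₀ one_pos)
    (F' := fun z x => F x * (Complex.exp (2 * x * z) * (2 * x)))
    (bound := fun x => ‖F x * Complex.exp (2 * x * (R : ℂ))‖ +
      ‖F x * Complex.exp (2 * x * ((-R : ℝ) : ℂ))‖)
    (Filter.Eventually.of_forall fun z => (hF z).aestronglyMeasurable) (hF z₀) ?_ ?_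
    ((hF _).norm.add (hF _).norm) ?_).2.differentiableAt
  · exact hFm.mul (by fun_prop)
  · refine Filter.Eventually.of_forall fun x z hz => ?_
    have hre : |z.re| ≤ R - 1 := by
      have h1 : |(z - z₀).re| ≤ ‖z - z₀‖ := Complex.abs_re_le_norm _
      have h2 : ‖z - z₀‖ < 1 := by simpa [dist_eq_norm] using hz
      have h3 : |z.re| ≤ |(z - z₀).re| + |z₀.re| := by
        simpa using abs_add_le (z - z₀).re z₀.re
      simp only [R]; linarith
    have e1 : ∀ w : ℂ, ‖Complex.exp (2 * x * w)‖ = Real.exp (2 * x * w.re) := by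
      intro w; simp [Complex.norm_exp]
    have e2 : ‖(2 * x : ℂ)‖ = |2 * x| := by
      rw [← Real.norm_eq_abs, ← Complex.norm_real]; simp
    simp only [norm_mul (F x), e1, Complex.ofReal_re]
    rw [norm_mul (Complex.exp _), e1, e2, ← mul_add]
    refine mul_le_mul_of_nonneg_left ?_ (norm_nonneg _)
    have h4 : |2 * x| ≤ Real.exp |2 * x| := by linarith [Real.add_one_le_exp |2 * x|]
    have h5 : 2 * x * z.re ≤ |2 * x| * (R - 1) :=
      (le_abs_self _).trans (by rw [abs_mul]; gcongr)
    calc Real.exp (2 * x * z.re) * |2 * x|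
        ≤ Real.exp (|2 * x| * (R - 1)) * Real.exp |2 * x| := by gcongr
      _ = Real.exp (|2 * x| * R) := by rw [← Real.exp_add]; ring_nf
      _ ≤ _ := by
        rcases abs_cases (2 * x) with ⟨h, _⟩ | ⟨h, _⟩ <;> rw [h]
        · linarith [Real.exp_pos (2 * x * -R)]
        · have : -(2 * x) * R = 2 * x * -R := by ring
          rw [this]; linarith [Real.exp_pos (2 * x * R)]
  · refine Filter.Eventually.of_forall fun x z _ => ?_
    have : HasDerivAt (fun z : ℂ => 2 * (x : ℂ) * z) (2 * x) z := by
      simpa using (hasDerivAt_id z).const_mul (2 * (x : ℂ))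
    exact this.cexp.const_mul (F x)

theorem bargmannIntegrand_eq (f : ℝ → ℂ) (z : ℂ) :
    bargmannIntegrand f z =
      fun x : ℝ => f x * Complex.exp (-(x : ℂ) ^ 2 + 2 * z * x + -(z ^ 2 / 2)) := by
  funext x
  rw [bargmannIntegrand]
  ring_nf

theorem integrable_bargmannIntegrand {f : ℝ → ℂ} {p : ℝ≥0∞} (hp : 1 ≤ p) (hf : MemLp f p) (z : ℂ) :
    Integrable (bargmannIntegrand f z) := by
  rw [bargmannIntegrand_eq]
  exact integrable_mul_cexp_quadratic hp hf _ _

theorem differentiable_bargmann {f : ℝ → ℂ} {p : ℝ≥0∞} (hp : 1 ≤ p) (hf : MemLp f p) :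
    Differentiable ℂ (bargmann f) := by
  have hF : ∀ z : ℂ, Integrable fun x : ℝ =>
      (f x * Complex.exp (-(x : ℂ) ^ 2)) * Complex.exp (2 * x * z) := by
    intro z
    refine (integrable_mul_cexp_quadratic hp hf (2 * z) 0).congr
      (Filter.Eventually.of_forall fun x => ?_)
    simp only [mul_assoc, ← Complex.exp_add]
    ring_nf
  have heq : bargmann f = fun z => (((2 / Real.pi) ^ (1 / 4 : ℝ) : ℝ) : ℂ) *
      (Complex.exp (-(z ^ 2 / 2)) *
        ∫ x : ℝ, (f x * Complex.exp (-(x : ℂ) ^ 2)) * Complex.exp (2 * x * z)) := by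
    funext z
    rw [bargmann, bargmannIntegrand_eq, ← integral_const_mul (Complex.exp _)]
    congr 2
    funext x
    simp only [Complex.exp_add]
    ring_nf
  rw [heq]
  exact Differentiable.const_mul (Differentiable.mul (by fun_prop)
    (differentiable_integral_mul_cexp hF)) _

/-! ### The windowed Fourier transform and the endpoint bounds -/

/-- Multiplication by the Gaussian window `e^{-(x-u)²}` centred at `u`. -/
noncomputable def gaussianWindow (f : ℝ → ℂ) (u x : ℝ) : ℂ :=
  f x * ((Real.exp (-(x - u) ^ 2) : ℝ) : ℂ)

/-- With `z = u + iv`, the total exponent `2xz - x² - z²/2 - |z|²/2` equals `-(x-u)² + 2ixv - iuv`.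
-/
theorem bargmannIntegrand_mul_weight (f : ℝ → ℂ) (z : ℂ) (x : ℝ) :
    bargmannIntegrand f z x * ((Real.exp (-(1 / 2) * ‖z‖ ^ 2) : ℝ) : ℂ) =
      Complex.exp (-(z.re * z.im : ℝ) * Complex.I) *
        (Complex.exp (↑(-2 * Real.pi * x * (-(z.im / Real.pi))) * Complex.I) •
          gaussianWindow f z.re x) := by
  rw [bargmannIntegrand, gaussianWindow, smul_eq_mul, Complex.ofReal_exp, Complex.ofReal_exp,
    mul_left_comm (Complex.exp (_ * Complex.I)) (f x), mul_left_comm (Complex.exp _) (f x),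
    mul_assoc, ← Complex.exp_add, ← Complex.exp_add, ← Complex.exp_add]
  congr 2
  have h1 : -2 * Real.pi * x * (-(z.im / Real.pi)) = 2 * x * z.im := by
    field_simp
  have h2 : ‖z‖ ^ 2 = z.re ^ 2 + z.im ^ 2 := by
    rw [← Complex.normSq_eq_norm_sq, Complex.normSq_apply]; ring
  rw [h1, h2]
  have h3 : z = z.re + z.im * Complex.I := (Complex.re_add_im z).symm
  generalize z.re = u at *
  generalize z.im = v at *
  subst h3
  push_cast
  linear_combination (-(v : ℂ) ^ 2 / 2) * Complex.I_sq

open scoped FourierTransform in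
/-- Up to a unimodular factor, the weighted Bargmann transform is a windowed Fourier transform. -/
theorem fockWeighted_bargmann (f : ℝ → ℂ) (z : ℂ) :
    fockWeighted (bargmann f) z = (((2 / Real.pi) ^ (1 / 4 : ℝ) : ℝ) : ℂ) *
      (Complex.exp (-(z.re * z.im : ℝ) * Complex.I) *
        𝓕 (gaussianWindow f z.re) (-(z.im / Real.pi))) := by
  rw [fockWeighted, bargmann, mul_assoc, ← integral_mul_const,
    Real.fourier_real_eq_integral_exp_smul,
    ← integral_const_mul (Complex.exp _)]
  simp_rw [bargmannIntegrand_mul_weight]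

open scoped FourierTransform in
theorem norm_fockWeighted_bargmann (f : ℝ → ℂ) (z : ℂ) :
    ‖fockWeighted (bargmann f) z‖ = (2 / Real.pi) ^ (1 / 4 : ℝ) *
      ‖𝓕 (gaussianWindow f z.re) (-(z.im / Real.pi))‖ := by
  have h : ‖Complex.exp (-(z.re * z.im : ℝ) * Complex.I)‖ = 1 := by
    rw [← Complex.ofReal_neg, Complex.norm_exp_ofReal_mul_I]
  rw [fockWeighted_bargmann, norm_mul, norm_mul, h, one_mul, Complex.norm_real,
    Real.norm_of_nonneg (by positivity)]

theorem integrable_gaussianWindow {f : ℝ → ℂ}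
    (hf : ∀ z, Integrable (bargmannIntegrand f z)) (u : ℝ) : Integrable (gaussianWindow f u) := by
  -- At the real point `z = u` both phases are trivial, so the weighted integrand is the window
  -- itself.
  refine ((hf u).mul_const ((Real.exp (-(1 / 2) * ‖(u : ℂ)‖ ^ 2) : ℝ) : ℂ)).congr
    (Filter.Eventually.of_forall fun x => ?_)
  simp only [bargmannIntegrand_mul_weight]
  simp

theorem norm_gaussianWindow (f : ℝ → ℂ) (u x : ℝ) :
    ‖gaussianWindow f u x‖ = ‖f x‖ * Real.exp (-(x - u) ^ 2) := by
  rw [gaussianWindow, norm_mul, Complex.norm_real, Real.norm_of_nonneg (Real.exp_pos _).le]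

/-- The norm of the Bargmann transform from `L^∞` to `F^∞` is at most this constant. -/
noncomputable def bargmannSupConst : ℝ := (2 / Real.pi) ^ (1 / 4 : ℝ) * √Real.pi

theorem bargmannSupConst_pos : 0 < bargmannSupConst := by
  unfold bargmannSupConst; positivity

theorem norm_fockWeighted_bargmann_le {f : ℝ → ℂ} {M : ℝ} (hM : ∀ᵐ x, ‖f x‖ ≤ M) (z : ℂ) :
    ‖fockWeighted (bargmann f) z‖ ≤ bargmannSupConst * M := by
  rw [norm_fockWeighted_bargmann, bargmannSupConst, mul_assoc]
  refine mul_le_mul_of_nonneg_left ?_ (by positivity)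
  have hgauss : Integrable fun x : ℝ => Real.exp (-(x - z.re) ^ 2) := by
    simpa using (integrable_exp_neg_mul_sq one_pos).comp_sub_right z.re
  calc _ ≤ ∫ x, ‖gaussianWindow f z.re x‖ := by
        rw [Real.fourier_real_eq]
        refine (norm_integral_le_integral_norm _).trans_eq ?_
        simp
    _ ≤ ∫ x, M * Real.exp (-(x - z.re) ^ 2) := by
        refine integral_mono_of_nonneg (Filter.Eventually.of_forall fun _ => norm_nonneg _)
          (hgauss.const_mul M) ?_
        filter_upwards [hM] with x hx
        simp only [norm_gaussianWindow]
        gcongr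
    _ = √Real.pi * M := by
        rw [integral_const_mul, integral_sub_right_eq_self (fun x => Real.exp (-x ^ 2)), mul_comm]
        congr 1
        simpa using integral_gaussian 1

open scoped FourierTransform in
-- Plancherel for fixed `u`; the factor `π` is the Jacobian of `v ↦ -v/π`.
theorem lintegral_fourier_gaussianWindow {f : ℝ → ℂ} (hf2 : MemLp f 2)
    (hf : ∀ z, Integrable (bargmannIntegrand f z)) (u : ℝ) :
    ∫⁻ v : ℝ, ‖𝓕 (gaussianWindow f u) (-(v / Real.pi))‖ₑ ^ (2 : ℝ) =
      ENNReal.ofReal Real.pi * ∫⁻ x, ‖gaussianWindow f u x‖ₑ ^ (2 : ℝ) := by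
  have hint := integrable_gaussianWindow hf u
  have hmem : MemLp (gaussianWindow f u) 2 := by
    refine hf2.of_le hint.aestronglyMeasurable (Filter.Eventually.of_forall fun x => ?_)
    rw [norm_gaussianWindow]
    exact mul_le_of_le_one_right (norm_nonneg _) (Real.exp_le_one_iff.2 (by nlinarith))
  have hpl := congrArg (· ^ (2 : ℝ)) (eLpNorm_two_fourier_eq hint hmem)
  have e (g : ℝ → ℂ) : eLpNorm g 2 ^ (2 : ℝ) = ∫⁻ x, ‖g x‖ₑ ^ (2 : ℝ) :=
    eLpNorm_nnreal_pow_eq_lintegral (p := 2) two_ne_zero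
  simp only [e] at hpl
  have hc : -Real.pi⁻¹ ≠ 0 := by simp [Real.pi_ne_zero]
  have hmap := lintegral_map_equiv (μ := volume)
    (fun w => ‖𝓕 (gaussianWindow f u) w‖ₑ ^ (2 : ℝ)) (Homeomorph.mulLeft₀ _ hc).toMeasurableEquiv
  have hvol : Measure.map (Homeomorph.mulLeft₀ _ hc).toMeasurableEquiv volume =
      ENNReal.ofReal Real.pi • (volume : Measure ℝ) := by
    have := Real.map_volume_mul_left hc
    simpa [abs_of_pos Real.pi_pos] using this
  rw [hvol, lintegral_smul_measure, hpl, smul_eq_mul] at hmap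
  rw [hmap]
  refine lintegral_congr fun v => ?_
  congr 4
  simp [div_eq_mul_inv, mul_comm]

open scoped FourierTransform in
/-- The `L²` bound for the Bargmann transform. -/
theorem exists_lintegral_fockWeighted_bargmann_sq_le :
    ∃ B : ℝ≥0∞, B ≠ ∞ ∧ ∀ f : ℝ → ℂ, MemLp f 2 → (∀ z, Integrable (bargmannIntegrand f z)) →
      ∫⁻ z, ‖fockWeighted (bargmann f) z‖ₑ ^ (2 : ℝ) ≤ B * ∫⁻ x, ‖f x‖ₑ ^ (2 : ℝ) := by
  set κ : ℝ := (2 / Real.pi) ^ (1 / 4 : ℝ) with hκ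
  set w : ℝ → ℝ≥0∞ := fun t => ENNReal.ofReal (Real.exp (-2 * t ^ 2)) with hw
  have hwfin : ∫⁻ t, w t ≠ ∞ :=
    ((integrable_exp_neg_mul_sq two_pos).lintegral_lt_top).ne
  refine ⟨ENNReal.ofReal (κ ^ 2) * (ENNReal.ofReal Real.pi * ∫⁻ t, w t),
    by finiteness, fun f hf2 hf => ?_⟩
  have hcont : Continuous (fockWeighted (bargmann f)) := by
    have := (differentiable_bargmann (p := 2) (by norm_num) hf2).continuous
    unfold fockWeighted
    fun_prop
  have hnorm (u v : ℝ) : ‖fockWeighted (bargmann f) ⟨u, v⟩‖ₑ ^ (2 : ℝ) = ENNReal.ofReal (κ ^ 2) *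
      ‖𝓕 (gaussianWindow f u) (-(v / Real.pi))‖ₑ ^ (2 : ℝ) := by
    have hκ0 : 0 ≤ κ := by positivity
    rw [← ofReal_norm, norm_fockWeighted_bargmann, ENNReal.ofReal_mul hκ0, ofReal_norm,
      ENNReal.mul_rpow_of_nonneg _ _ two_pos.le, ENNReal.ofReal_rpow_of_nonneg hκ0 two_pos.le,
      Real.rpow_two]
  have hwindow (u x : ℝ) :
      ‖gaussianWindow f u x‖ₑ ^ (2 : ℝ) = ‖f x‖ₑ ^ (2 : ℝ) * w (x - u) := by
    rw [← ofReal_norm, norm_gaussianWindow, ENNReal.ofReal_mul (norm_nonneg _), ofReal_norm,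
      ENNReal.mul_rpow_of_nonneg _ _ two_pos.le,
      ENNReal.ofReal_rpow_of_nonneg (Real.exp_pos _).le two_pos.le, ← Real.exp_mul]
    simp only [hw]
    ring_nf
  have hmeas : AEMeasurable (Function.uncurry fun u x : ℝ => ‖f x‖ₑ ^ (2 : ℝ) * w (x - u))
      ((volume : Measure ℝ).prod volume) := by
    refine AEMeasurable.mul ?_ (by fun_prop)
    exact (hf2.aestronglyMeasurable.comp_snd (μ := (volume : Measure ℝ))).enorm.pow_const _
  calc ∫⁻ z, ‖fockWeighted (bargmann f) z‖ₑ ^ (2 : ℝ)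
      = ∫⁻ p : ℝ × ℝ, ‖fockWeighted (bargmann f) ⟨p.1, p.2⟩‖ₑ ^ (2 : ℝ) :=
        (Complex.volume_preserving_equiv_real_prod.symm.lintegral_comp
          (f := fun z => ‖fockWeighted (bargmann f) z‖ₑ ^ (2 : ℝ)) (by fun_prop)).symm
    _ = ∫⁻ u : ℝ, ∫⁻ v : ℝ, ‖fockWeighted (bargmann f) ⟨u, v⟩‖ₑ ^ (2 : ℝ) := by
        refine lintegral_prod _ (Measurable.aemeasurable ?_)
        exact (hcont.measurable.comp
          Complex.measurableEquivRealProd.symm.measurable).enorm.pow_const _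
    _ = ENNReal.ofReal (κ ^ 2) * (ENNReal.ofReal Real.pi *
          ∫⁻ u : ℝ, ∫⁻ x : ℝ, ‖f x‖ₑ ^ (2 : ℝ) * w (x - u)) := by
        simp_rw [hnorm, lintegral_const_mul' _ _ ENNReal.ofReal_ne_top,
          lintegral_fourier_gaussianWindow hf2 hf, lintegral_const_mul' _ _ ENNReal.ofReal_ne_top,
          hwindow]
    _ = ENNReal.ofReal (κ ^ 2) * (ENNReal.ofReal Real.pi *
          ∫⁻ x : ℝ, ‖f x‖ₑ ^ (2 : ℝ) * ∫⁻ t, w t) := by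
        -- After the swap, translation and reflection invariance make the integral over `u`
        -- independent of `x`.
        rw [lintegral_lintegral_swap hmeas]
        congr 2
        refine lintegral_congr fun x => ?_
        rw [lintegral_const_mul _ (by fun_prop), lintegral_sub_left_eq_self w x]
    _ ≤ _ := by
        rw [lintegral_mul_const' _ _ hwfin]
        exact le_of_eq (by ring)

/-! ### Linearity and continuity -/

theorem bargmann_add {f g : ℝ → ℂ} (hf : ∀ z, Integrable (bargmannIntegrand f z))
    (hg : ∀ z, Integrable (bargmannIntegrand g z)) :
    bargmann (f + g) = bargmann f + bargmann g := by
  funext z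
  simp only [bargmann, Pi.add_apply, ← mul_add, ← integral_add (hf z) (hg z)]
  simp [bargmannIntegrand, add_mul]

theorem bargmann_smul (c : ℂ) (f : ℝ → ℂ) : bargmann (c • f) = c • bargmann f := by
  funext z
  simp only [bargmann, Pi.smul_apply, smul_eq_mul, mul_left_comm c]
  rw [← integral_const_mul c]
  simp only [bargmannIntegrand, Pi.smul_apply, smul_eq_mul, mul_assoc]

theorem bargmann_congr_ae {f g : ℝ → ℂ} (h : f =ᵐ[volume] g) : bargmann f = bargmann g := by
  funext z
  rw [bargmann, bargmann]
  congr 1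
  refine integral_congr_ae ?_
  filter_upwards [h] with x hx
  rw [bargmannIntegrand, bargmannIntegrand, hx]

theorem continuous_fockWeighted_bargmann {f : ℝ → ℂ} {p : ℝ≥0∞} (hp : 1 ≤ p) (hf : MemLp f p) :
    Continuous (fockWeighted (bargmann f)) := by
  have := (differentiable_bargmann hp hf).continuous
  unfold fockWeighted
  fun_prop

/-! ### Interpolation between the endpoints -/

/-- Cutting off the part of an `L^p` function below a positive level leaves an `L²` function
when `2 ≤ p < ∞`. -/
theorem memLp_two_indicator_lt_norm {f : ℝ → ℂ} (hfm : Measurable f) {p : ℝ≥0∞} (hp : 2 ≤ p)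
    (hp' : p ≠ ∞) (hf : MemLp f p) {t : ℝ} (ht : 0 < t) :
    MemLp ({x | t < ‖f x‖}.indicator f) 2 := by
  have hs : MeasurableSet {x | t < ‖f x‖} := measurableSet_lt measurable_const hfm.norm
  have hfin : volume {x | t < ‖f x‖} ≠ ∞ := by
    refine ((measure_mono fun x hx => ?_).trans_lt
      (hf.meas_ge_lt_top' (ε := ENNReal.ofReal t) (by positivity) hp' (by simpa using ht))).ne
    rw [Set.mem_ofPred_eq, ← enorm_eq_nnnorm, ← ofReal_norm]
    exact ENNReal.ofReal_le_ofReal (le_of_lt hx)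
  rw [memLp_indicator_iff_restrict hs]
  have : IsFiniteMeasure (volume.restrict {x | t < ‖f x‖}) :=
    isFiniteMeasure_restrict.2 hfin
  exact (hf.restrict _).mono_exponent hp

/-- The Bargmann transform maps `L^p` boundedly into the Gaussian-weighted `L^p` space for
`2 < p < ∞`. -/
theorem exists_lintegral_fockWeighted_bargmann_rpow_le {p : ℝ≥0∞} (hp : 2 < p) (hp' : p ≠ ∞) :
    ∃ B : ℝ≥0∞, B ≠ ∞ ∧ ∀ f : ℝ → ℂ, Measurable f → MemLp f p →
      ∫⁻ z, ‖fockWeighted (bargmann f) z‖ₑ ^ p.toReal ≤ B * ∫⁻ x, ‖f x‖ₑ ^ p.toReal := by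
  obtain ⟨B, hB, hB2⟩ := exists_lintegral_fockWeighted_bargmann_sq_le
  have hq : 2 < p.toReal := by
    simpa using (ENNReal.toReal_lt_toReal (by norm_num) hp').2 hp
  set q := p.toReal
  set A := bargmannSupConst
  have hA : 0 < A := bargmannSupConst_pos
  have hp1 : 1 ≤ p := le_trans (by norm_num) hp.le
  set D : ℝ≥0∞ := B * ENNReal.ofReal (A ^ (-2 : ℝ))
  have hD : D ≠ ∞ := by finiteness
  -- `(2A)^q` undoes the rescaling of the transform by `2A` below; `D` collects the `L²` constant
  -- and the `A⁻²` from Chebyshev.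
  refine ⟨ENNReal.ofReal ((2 * A) ^ q) * (ENNReal.ofReal (q / (q - 2)) * D), by finiteness,
    fun f hfm hf => ?_⟩
  have hWm := (continuous_fockWeighted_bargmann hp1 hf).measurable
  have key := lintegral_rpow_le_of_meas_lt_le (μ := volume) (ν := (volume : Measure ℂ))
    (f := fun x => ‖f x‖) hfm.norm (fun _ => norm_nonneg _)
    (h := fun z => ‖fockWeighted (bargmann f) z‖ / (2 * A)) (hWm.norm.div_const _).aemeasurable
    (fun _ => by positivity) hq hD ?_
  · have e1 (z : ℂ) : ENNReal.ofReal ((2 * A) ^ q) *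
        ENNReal.ofReal ((‖fockWeighted (bargmann f) z‖ / (2 * A)) ^ q) =
          ‖fockWeighted (bargmann f) z‖ₑ ^ q := by
      rw [← ENNReal.ofReal_mul (by positivity), ← Real.mul_rpow (by positivity) (by positivity),
        mul_div_cancel₀ _ (by positivity), ← ENNReal.ofReal_rpow_of_nonneg (norm_nonneg _)
        (by linarith), ofReal_norm]
    have e2 (x : ℝ) : ENNReal.ofReal (‖f x‖ ^ q) = ‖f x‖ₑ ^ q := by
      rw [← ENNReal.ofReal_rpow_of_nonneg (norm_nonneg _) (by linarith), ofReal_norm]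
    simp_rw [e2] at key
    simp_rw [← e1]
    rw [lintegral_const_mul' _ _ ENNReal.ofReal_ne_top, mul_assoc]
    gcongr
  · intro t ht
    set s : Set ℝ := {x | t < ‖f x‖}
    have hs : MeasurableSet s := measurableSet_lt measurable_const hfm.norm
    have hint := fun z => integrable_bargmannIntegrand hp1 hf z
    have hind (s' : Set ℝ) (hs' : MeasurableSet s') (z : ℂ) :
        Integrable (bargmannIntegrand (s'.indicator f) z) := by
      refine ((hint z).indicator hs').congr (Filter.Eventually.of_forall fun x => ?_)
      by_cases hx : x ∈ s' <;> simp [bargmannIntegrand, hx]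
    have hsplit : bargmann f = bargmann (s.indicator f) + bargmann (sᶜ.indicator f) := by
      rw [← bargmann_add (hind s hs) (hind _ hs.compl), Set.indicator_self_add_compl]
    have hsmall (z : ℂ) : ‖fockWeighted (bargmann (sᶜ.indicator f)) z‖ ≤ A * t := by
      refine norm_fockWeighted_bargmann_le (Filter.Eventually.of_forall fun x => ?_) z
      by_cases hx : x ∈ s
      · simpa [hx] using ht.le
      · rw [Set.indicator_of_mem (Set.mem_compl hx)]
        exact not_lt.1 hx
    have hbig : MemLp (s.indicator f) 2 := memLp_two_indicator_lt_norm hfm hp.le hp' hf ht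
    have hle := hB2 _ hbig (hind s hs)
    have hAt : 0 < A * t := by positivity
    have hsub : {z | t < ‖fockWeighted (bargmann f) z‖ / (2 * A)} ⊆
        {z | ENNReal.ofReal (A * t) ^ (2 : ℝ) ≤
          ‖fockWeighted (bargmann (s.indicator f)) z‖ₑ ^ (2 : ℝ)} := by
      intro z hz
      rw [Set.mem_ofPred_eq, lt_div_iff₀ (by positivity)] at hz
      have htri : ‖fockWeighted (bargmann f) z‖ ≤
          ‖fockWeighted (bargmann (s.indicator f)) z‖ +
            ‖fockWeighted (bargmann (sᶜ.indicator f)) z‖ := by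
        rw [hsplit, fockWeighted, Pi.add_apply, add_mul]
        exact norm_add_le _ _
      have := hsmall z
      rw [Set.mem_ofPred_eq, ← ofReal_norm]
      gcongr
      linarith
    refine (measure_mono hsub).trans ((meas_ge_le_lintegral_div
      ((continuous_fockWeighted_bargmann (p := 2) (by norm_num) hbig).measurable.enorm.pow_const
        _).aemeasurable (by simpa using hAt) (by finiteness)).trans ?_)
    have e3 : ∫⁻ x, ‖s.indicator f x‖ₑ ^ (2 : ℝ) = ∫⁻ x in s, ENNReal.ofReal (‖f x‖ ^ (2 : ℝ)) := by
      rw [← lintegral_indicator hs]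
      refine lintegral_congr fun x => ?_
      by_cases hx : x ∈ s
      · simp only [hx, Set.indicator_of_mem]
        rw [← ENNReal.ofReal_rpow_of_nonneg (norm_nonneg _) two_pos.le, ofReal_norm]
      · simp [hx]
    have e4 : (ENNReal.ofReal (A * t) ^ (2 : ℝ))⁻¹ =
        ENNReal.ofReal (A ^ (-2 : ℝ)) * ENNReal.ofReal (t ^ (-2 : ℝ)) := by
      rw [← ENNReal.ofReal_mul (by positivity), ← Real.mul_rpow hA.le ht.le,
        ← ENNReal.rpow_neg, ENNReal.ofReal_rpow_of_pos hAt]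
    rw [← e3, div_eq_mul_inv, e4]
    calc _ ≤ B * (∫⁻ x, ‖s.indicator f x‖ₑ ^ (2 : ℝ)) * _ := by gcongr
      _ = _ := by simp only [D]; ring

/-- The Bargmann transform maps `L^p` boundedly into the Gaussian-weighted `L^p` space for
`2 ≤ p ≤ ∞`. -/
theorem exists_eLpNorm_fockWeighted_bargmann_le {p : ℝ≥0∞} (hp : 2 ≤ p) :
    ∃ C : ℝ≥0∞, C ≠ ∞ ∧ ∀ f : ℝ → ℂ, Measurable f → MemLp f p →
      eLpNorm (fockWeighted (bargmann f)) p volume ≤ C * eLpNorm f p volume := by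
  rcases eq_or_ne p ∞ with rfl | hp'
  · refine ⟨ENNReal.ofReal bargmannSupConst, by finiteness, fun f _ hf => ?_⟩
    have hM : ∀ᵐ x, ‖f x‖ ≤ (eLpNorm f ∞ volume).toReal := by
      filter_upwards [enorm_ae_le_eLpNormEssSup f volume] with x hx
      rw [← eLpNorm_exponent_top] at hx
      simpa using ENNReal.toReal_mono hf.2.ne hx
    rw [eLpNorm_exponent_top (f := fockWeighted _)]
    refine eLpNormEssSup_le_of_ae_enorm_bound (Filter.Eventually.of_forall fun z => ?_)
    rw [← ofReal_norm]
    refine (ENNReal.ofReal_le_ofReal (norm_fockWeighted_bargmann_le hM z)).trans_eq ?_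
    rw [ENNReal.ofReal_mul bargmannSupConst_pos.le, ENNReal.ofReal_toReal hf.2.ne]
  · have hp0 : p ≠ 0 := (lt_of_lt_of_le two_pos hp).ne'
    have hq0 : 0 < p.toReal := ENNReal.toReal_pos hp0 hp'
    obtain ⟨B, hB, h⟩ : ∃ B : ℝ≥0∞, B ≠ ∞ ∧ ∀ f : ℝ → ℂ, Measurable f → MemLp f p →
        ∫⁻ z, ‖fockWeighted (bargmann f) z‖ₑ ^ p.toReal ≤ B * ∫⁻ x, ‖f x‖ₑ ^ p.toReal := by
      rcases hp.eq_or_lt with rfl | hp2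
      · obtain ⟨B, hB, h⟩ := exists_lintegral_fockWeighted_bargmann_sq_le
        exact ⟨B, hB, fun f _ hf => by
          simpa using h f hf (integrable_bargmannIntegrand (by norm_num) hf)⟩
      · exact exists_lintegral_fockWeighted_bargmann_rpow_le hp2 hp'
    refine ⟨B ^ (1 / p.toReal), by finiteness, fun f hfm hf => ?_⟩
    rw [eLpNorm_eq_lintegral_rpow_enorm_toReal hp0 hp',
      eLpNorm_eq_lintegral_rpow_enorm_toReal hp0 hp',
      ← ENNReal.mul_rpow_of_nonneg _ _ (by positivity)]
    gcongr
    exact h f hfm hf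

/-! ### Passage to the Fock space -/

/-- The norm of `F^p` is at most a constant times the weighted `L^p` norm. -/
theorem fockENorm_le {p : ℝ≥0∞} (hp : p ≠ 0) {g : ℂ → ℂ} (hg : Continuous g) :
    fockENorm p g ≤ (if p = ∞ then 1 else
      ENNReal.ofReal (p.toReal / (2 * Real.pi)) ^ (1 / p.toReal)) *
        eLpNorm (fockWeighted g) p volume := by
  unfold fockENorm
  split_ifs with h
  · subst h
    have hc : Continuous (fockWeighted g) := by unfold fockWeighted; fun_prop
    rw [one_mul, eLpNorm_exponent_top]
    refine iSup_le fun z => ?_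
    have hae := enorm_ae_le_eLpNormEssSup (fockWeighted g) volume
    have hcl : IsClosed {z | ‖fockWeighted g z‖ₑ ≤ eLpNormEssSup (fockWeighted g) volume} :=
      isClosed_le hc.enorm continuous_const
    -- A closed set of full measure is dense, hence everything: by continuity the essential supremum
    -- bounds every value.
    have hd := Measure.dense_of_ae hae
    exact (hcl.closure_eq ▸ hd z :)
  · rw [eLpNorm_eq_lintegral_rpow_enorm_toReal hp h, ENNReal.mul_rpow_of_nonneg _ _ (by positivity)]

theorem theorem28 (p : ℝ≥0∞) (hp : 2 ≤ p) :
    ∃ T : Lp ℂ p (volume : Measure ℝ) →ₗ[ℂ] fockSpace p,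
      (∀ (f : Lp ℂ p (volume : Measure ℝ)) (z : ℂ),
        Integrable (bargmannIntegrand f z) volume ∧ (T f : ℂ → ℂ) z = bargmann f z) ∧
      ∃ C : ℝ≥0, ∀ f : Lp ℂ p (volume : Measure ℝ),
        fockENorm p (T f : ℂ → ℂ) ≤ (C : ℝ≥0∞) * ‖f‖ₑ := by
  have hp1 : 1 ≤ p := le_trans (by norm_num) hp
  have hp0 : p ≠ 0 := (lt_of_lt_of_le two_pos hp).ne'
  obtain ⟨C, hC, hbound⟩ := exists_eLpNorm_fockWeighted_bargmann_le hp
  have hb (f : Lp ℂ p (volume : Measure ℝ)) :=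
    hbound f (Lp.stronglyMeasurable f).measurable (Lp.memLp f)
  have hint (f : Lp ℂ p (volume : Measure ℝ)) := integrable_bargmannIntegrand hp1 (Lp.memLp f)
  have hmem (f : Lp ℂ p (volume : Measure ℝ)) : bargmann f ∈ fockSpace p :=
    ⟨differentiable_bargmann hp1 (Lp.memLp f),
      (continuous_fockWeighted_bargmann hp1 (Lp.memLp f)).aestronglyMeasurable,
      (hb f).trans_lt (ENNReal.mul_lt_top hC.lt_top (Lp.memLp f).2)⟩
  refine ⟨{ toFun := fun f => ⟨bargmann f, hmem f⟩
            map_add' := fun f g => Subtype.ext ?_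
            map_smul' := fun c f => Subtype.ext ?_ }, fun f z => ⟨hint f z, rfl⟩, ?_⟩
  · exact (bargmann_congr_ae (Lp.coeFn_add f g)).trans (bargmann_add (hint f) (hint g))
  · exact (bargmann_congr_ae (Lp.coeFn_smul c f)).trans (bargmann_smul c f)
  · set K : ℝ≥0∞ := if p = ∞ then 1 else
      ENNReal.ofReal (p.toReal / (2 * Real.pi)) ^ (1 / p.toReal) with hK
    have hKtop : K ≠ ∞ := by
      rw [hK]
      split_ifs
      · exact ENNReal.one_ne_top
      · finiteness
    refine ⟨(K * C).toNNReal, fun f => ?_⟩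
    rw [ENNReal.coe_toNNReal (by finiteness), mul_assoc, Lp.enorm_def]
    exact (fockENorm_le hp0 (hmem f).1.continuous).trans (by gcongr; exact hb f)
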